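/- Let $(R,\mathfrak m)$ be a Cohen–Macaulay (Noetherian) local ring of Krull dimension $d\ge 1$ with infinite residue field, let $I$ be an $\mathfrak m$-primary ideal, and let $x\in I$ be a superficial element for $I$, i.e. there is an integer $c\ge 1$ such that $(I^{n+1}:x)\cap I^{c}=I^{n}$ for all $n\ge c$. Put $S=R/(x)$ and $I'=I/(x)\subseteq S$. For an ideal $J$ that is primary to the maximal ideal of a Noetherian local ring $A$, let $H_J(n)=\lambda(A/J^n)$ for $n\in\mathbb Z$ (where $\lambda$ is length and $J^n=A$ for $n\le 0$, so $H_J(n)=0$ for $n\le 0$), let $P_J$ be the polynomial with $P_J(n)=H_J(n)$ for all $n\gg 0$, and let $\operatorname{n}(J)=\min\{n\in\mathbb Z : P_J(t)=H_J(t)\text{ for all } t>n\}$ be the postulation number of $J$. Let $\widetilde{J}=\bigcup_{k\ge 1}(J^{k+1}:J^{k})$ be the Ratliff–Rush closure of $J$, and let $\rho(I)=\min\{i\ge 1 : \widetilde{I^{n}}=I^{n}\text{ for all } n\ge i\}$. Then: 1. if $\operatorname{n}(I)>\rho(I)-1$, then $\operatorname{n}(I')=\operatorname{n}(I)+1$;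 2. if $\operatorname{n}(I)=\rho(I)-1$, then $\operatorname{n}(I')\le \operatorname{n}(I)+1$; 3. if $\operatorname{n}(I)<\rho(I)-1$, then $\operatorname{n}(I')\ge \operatorname{n}(I)+1$. -/

import Mathlib

open Polynomial Filter

/-- A Noetherian local ring `(R, 𝔪)` is Cohen–Macaulay if its depth equals its Krull dimension:
some `R`-regular sequence of elements of `𝔪` has length `dim R`. -/
def IsCohenMacaulayLocal (R : Type*) [CommRing R] [IsLocalRing R] : Prop :=
  IsNoetherianRing R ∧
    ∃ rs : List R, (∀ r ∈ rs, r ∈ IsLocalRing.maximalIdeal R) ∧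
      RingTheory.Sequence.IsRegular R rs ∧ (rs.length : WithBot ℕ∞) = ringKrullDim R

namespace Ideal

variable {R : Type*} [CommRing R]

/-- `I` is `𝔪`-primary: a primary ideal whose radical is the maximal ideal `𝔪`. -/
def IsMaximalPrimary [IsLocalRing R] (I : Ideal R) : Prop :=
  I.IsPrimary ∧ I.radical = IsLocalRing.maximalIdeal R

/-- The Hilbert–Samuel function `H_I(n) = λ(R / Iⁿ)` on all of `ℤ`, where `Iⁿ = R` for `n ≤ 0`
(so `H_I(n) = 0` there). -/
noncomputable def hilbertSamuelFun (I : Ideal R) (n : ℤ) : ℕ :=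
  (Module.length R (R ⧸ I ^ n.toNat)).toNat

/-- `P` is a Hilbert–Samuel polynomial of `I`: `P(n) = H_I(n)` for all large `n`. -/
def IsHilbertSamuelPoly (I : Ideal R) (P : ℚ[X]) : Prop :=
  ∀ᶠ n : ℤ in atTop, P.eval (n : ℚ) = I.hilbertSamuelFun n

/-- There is at most one Hilbert–Samuel polynomial. -/
theorem IsHilbertSamuelPoly.unique {I : Ideal R} {P Q : ℚ[X]}
    (hP : I.IsHilbertSamuelPoly P) (hQ : I.IsHilbertSamuelPoly Q) : P = Q := by
  obtain ⟨N, hN⟩ := eventually_atTop.1 (hP.and hQ)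
  refine Polynomial.eq_of_infinite_eval_eq P Q ?_
  refine ((Set.Ici_infinite N).image (Int.cast_injective (α := ℚ)).injOn).mono ?_
  rintro _ ⟨n, hn, rfl⟩
  exact (hN n hn).1.trans (hN n hn).2.symm

open Classical in
/-- The Hilbert–Samuel polynomial `P_I` (with junk value `0` when there is none). -/
noncomputable def hilbertSamuelPoly (I : Ideal R) : ℚ[X] :=
  if h : ∃ P : ℚ[X], I.IsHilbertSamuelPoly P then h.choose else 0

theorem IsHilbertSamuelPoly.hilbertSamuelPoly_eq {I : Ideal R} {P : ℚ[X]}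
    (hP : I.IsHilbertSamuelPoly P) : I.hilbertSamuelPoly = P := by
  have h : ∃ P : ℚ[X], I.IsHilbertSamuelPoly P := ⟨P, hP⟩
  rw [hilbertSamuelPoly, dif_pos h]
  exact h.choose_spec.unique hP

/-- The postulation number `n(I) = min {n ∈ ℤ : P_I(t) = H_I(t) for all t > n}`. -/
noncomputable def postulationNumber (I : Ideal R) : ℤ :=
  sInf {n : ℤ | ∀ t : ℤ, n < t → I.hilbertSamuelPoly.eval (t : ℚ) = I.hilbertSamuelFun t}

/-- The Ratliff–Rush closure of `I`: the union of the increasing chain of ideals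
`(Iⁿ⁺¹ : Iⁿ)`, `n ≥ 1`. -/
def ratliffRush (I : Ideal R) : Ideal R :=
  ⨆ n : ℕ, ⨆ _ : 1 ≤ n, (I ^ (n + 1)).colon (I ^ n : Ideal R)

/-- The supremum defining `ratliffRush` is the union. -/
theorem mem_ratliffRush {I : Ideal R} {a : R} :
    a ∈ I.ratliffRush ↔ ∃ n : ℕ, 1 ≤ n ∧ ∀ b ∈ I ^ n, a * b ∈ I ^ (n + 1) := by
  have hmono : Monotone fun n : ℕ ↦ (I ^ (n + 1)).colon ((I ^ n : Ideal R) : Set R) := by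
    refine monotone_nat_of_le_succ fun n a ha ↦ ?_
    rw [Submodule.mem_colon] at ha ⊢
    intro s hs
    have hs' : s ∈ I ^ n * I := by rwa [← pow_succ]
    rw [pow_succ]
    refine Submodule.mul_induction_on hs' (fun b hb c hc ↦ ?_) fun b c hb hc ↦ ?_
    · rw [smul_eq_mul, ← mul_assoc]
      exact Ideal.mul_mem_mul (ha b hb) hc
    · rw [smul_add]
      exact add_mem hb hc
  have h : I.ratliffRush = ⨆ n : ℕ, (I ^ (n + 1)).colon ((I ^ n : Ideal R) : Set R) :=
    le_antisymm (iSup_le fun n ↦ iSup_le fun _ ↦ le_iSup_of_le n le_rfl)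
      (iSup_le fun n ↦ le_trans (hmono n.le_succ)
        (le_iSup_of_le (n + 1) (le_iSup_of_le n.succ_pos le_rfl)))
  rw [h, Submodule.mem_iSup_of_directed _ hmono.directed_le]
  constructor
  · rintro ⟨n, hn⟩
    exact ⟨n + 1, n.succ_pos, Submodule.mem_colon.1 (hmono n.le_succ hn)⟩
  · rintro ⟨n, _, hn⟩
    exact ⟨n, Submodule.mem_colon.2 hn⟩

/-- The stability index of the Ratliff–Rush filtration of `I`: the least `i ≥ 1` such that the
Ratliff–Rush closure of `Iⁿ` is `Iⁿ` for all `n ≥ i`. -/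
noncomputable def stabilityIndex (I : Ideal R) : ℕ :=
  sInf {i : ℕ | 1 ≤ i ∧ ∀ n : ℕ, i ≤ n → (I ^ n).ratliffRush = I ^ n}

/-- `x` is a superficial element for `I`: `x ∈ I` and, for some positive `c`,
`(Iⁿ⁺¹ : x) ∩ I^c = Iⁿ` for all `n ≥ c`. -/
def IsSuperficial (I : Ideal R) (x : R) : Prop :=
  x ∈ I ∧ ∃ c : ℕ, 1 ≤ c ∧ ∀ n : ℕ, c ≤ n → (I ^ (n + 1)).colon {x} ⊓ I ^ c = I ^ n

/-- The ideal `I' = I / (x)` of `S = R / (x)`: the image of `I`. -/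
abbrev modElement (I : Ideal R) (x : R) : Ideal (R ⧸ Ideal.span {x}) :=
  I.map (Ideal.Quotient.mk (Ideal.span {x}))

end Ideal

/-! Write H, P for I and H', Q for I'. Multiplication by x gives H(t) = H'(t) + λ(R/(I^t : x)).
Depth makes x a nonzerodivisor, and Artin–Rees then gives (I^(n+1) : x) = I^n for n ≫ 0. Hence the
Ratliff–Rush closure of I^n is the union of the (I^(n+k) : x^k), and (I^(n+1) : x) = I^n for all n ≥
ρ, but not for n = ρ - 1 when ρ ≥ 2.

So H'(t) = H(t) - H(t-1) for t > ρ (and for t ≤ 0), whence Q(t) = P(t) - P(t-1). When n(I) ≥ ρ - 1,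
H' and Q agree beyond n(I) + 1. At t = n(I) + 1 exactly one of the two terms of Q is wrong, so Q(t)
≠ H'(t) whenever the difference formula holds there. If n(I) < ρ - 1 and ρ ≥ 2, then H'(ρ) > H(ρ) -
H(ρ-1) = Q(ρ), so n(I') ≥ ρ. The existence of P is proved by Noetherian induction in the Rees
algebra. -/

/-! ### Eventually polynomial sequences -/

/-- A sequence of rationals that agrees with a polynomial for all large arguments. -/
def EventuallyPolynomial (u : ℕ → ℚ) : Prop :=
  ∃ P : ℚ[X], ∀ᶠ n : ℕ in atTop, u n = P.eval (n : ℚ)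

namespace EventuallyPolynomial

variable {u v : ℕ → ℚ}

theorem congr (hu : EventuallyPolynomial u) (h : ∀ᶠ n in atTop, v n = u n) :
    EventuallyPolynomial v := by
  obtain ⟨P, hP⟩ := hu
  exact ⟨P, by filter_upwards [hP, h] with n h₁ h₂ using h₂.trans h₁⟩

theorem zero : EventuallyPolynomial fun _ ↦ 0 := ⟨0, by simp⟩

theorem add (hu : EventuallyPolynomial u) (hv : EventuallyPolynomial v) :
    EventuallyPolynomial fun n ↦ u n + v n := by
  obtain ⟨P, hP⟩ := hu
  obtain ⟨Q, hQ⟩ := hv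
  exact ⟨P + Q, by filter_upwards [hP, hQ] with n h₁ h₂ using by simp [h₁, h₂]⟩

theorem comp_sub (hu : EventuallyPolynomial u) (m : ℕ) :
    EventuallyPolynomial fun n ↦ u (n - m) := by
  obtain ⟨P, hP⟩ := hu
  refine ⟨P.comp (X - C (m : ℚ)), ?_⟩
  filter_upwards [(tendsto_sub_atTop_nat m).eventually hP, eventually_ge_atTop m] with n h hn
  simp [h, Nat.cast_sub hn]

/-- Every polynomial is the first difference of a polynomial. -/
theorem exists_eval_add_one_sub_eval (P : ℚ[X]) :
    ∃ Q : ℚ[X], ∀ t : ℚ, Q.eval (t + 1) - Q.eval t = P.eval t := by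
  induction P using Polynomial.induction_on' with
  | add P₁ P₂ h₁ h₂ =>
    obtain ⟨Q₁, h₁⟩ := h₁
    obtain ⟨Q₂, h₂⟩ := h₂
    refine ⟨Q₁ + Q₂, fun t ↦ ?_⟩
    rw [eval_add, eval_add, eval_add, ← h₁, ← h₂]
    ring
  | monomial k a =>
    -- The Bernoulli polynomials satisfy B_(k+1)(t+1) - B_(k+1)(t) = (k+1) t^k.
    refine ⟨C (a / (k + 1)) * Polynomial.bernoulli (k + 1), fun t ↦ ?_⟩
    have hk : (k : ℚ) + 1 ≠ 0 := by positivity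
    rw [add_comm t 1, eval_C_mul, eval_C_mul, bernoulli_eval_one_add, eval_monomial]
    push_cast
    field_simp
    simp [mul_assoc]

theorem of_succ_sub (h : EventuallyPolynomial fun n ↦ u (n + 1) - u n) :
    EventuallyPolynomial u := by
  obtain ⟨P, hP⟩ := h
  obtain ⟨Q, hQ⟩ := exists_eval_add_one_sub_eval P
  obtain ⟨N, hN⟩ := eventually_atTop.1 hP
  refine ⟨Q + C (u N - Q.eval (N : ℚ)), eventually_atTop.2 ⟨N, fun n hn ↦ ?_⟩⟩
  induction n, hn using Nat.le_induction with
  | base => simp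
  | succ n hn ih =>
    have h₁ := hN n hn
    have h₂ := hQ n
    simp only [eval_add, eval_C] at ih ⊢
    push_cast
    linarith

end EventuallyPolynomial

/-! ### Additivity of colengths -/

section Length

variable {R : Type*} [CommRing R]

theorem Ideal.length_quotient_eq_add {J K : Ideal R} (h : J ≤ K) :
    Module.length R (R ⧸ J) =
      Module.length R (R ⧸ K) + Module.length R (Submodule.map J.mkQ K) := by
  rw [Module.length_eq_add_of_exact (Submodule.map J.mkQ K).subtype (Submodule.map J.mkQ K).mkQ
    (Submodule.subtype_injective _) (Submodule.mkQ_surjective _)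
    (LinearMap.exact_subtype_mkQ _), add_comm,
    (Submodule.quotientQuotientEquivQuotient J K h).length_eq]

/-- Multiplication by `f` induces an isomorphism from `A / B`, where `B = A ∩ (J : f)`, to
`(J + fA) / J`. -/
theorem Ideal.length_quotient_add_length_quotient {J A B : Ideal R} {f : R}
    (hB : ∀ a, a ∈ B ↔ a ∈ A ∧ f * a ∈ J) :
    Module.length R (R ⧸ J) + Module.length R (R ⧸ A) =
      Module.length R (R ⧸ (J ⊔ Ideal.span {f} * A)) + Module.length R (R ⧸ B) := by
  have hBA : B ≤ A := fun a ha ↦ ((hB a).1 ha).1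
  rw [Ideal.length_quotient_eq_add (le_sup_left : J ≤ J ⊔ Ideal.span {f} * A),
    Ideal.length_quotient_eq_add hBA]
  let φ : A →ₗ[R] R ⧸ J := J.mkQ ∘ₗ LinearMap.mulLeft R f ∘ₗ A.subtype
  let ψ : A →ₗ[R] R ⧸ B := B.mkQ ∘ₗ A.subtype
  have hker : LinearMap.ker φ = LinearMap.ker ψ := by
    ext a
    simp only [φ, ψ, LinearMap.mem_ker, LinearMap.comp_apply, Submodule.mkQ_apply,
      Submodule.Quotient.mk_eq_zero, Submodule.subtype_apply, LinearMap.mulLeft_apply, hB]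
    exact ⟨fun h ↦ ⟨a.2, h⟩, fun h ↦ h.2⟩
  have hφ : LinearMap.range φ = Submodule.map J.mkQ (J ⊔ Ideal.span {f} * A) := by
    have : Ideal.span {f} * A = Submodule.map (LinearMap.mulLeft R f) A := by
      ext z
      simp [Ideal.mem_span_singleton_mul]
    rw [Submodule.map_sup, this, LinearMap.range_comp, LinearMap.range_comp,
      Submodule.range_subtype]
    simp
  have hψ : LinearMap.range ψ = Submodule.map B.mkQ A := by
    rw [LinearMap.range_comp, Submodule.range_subtype]
  have h : Module.length R (LinearMap.range φ) = Module.length R (LinearMap.range ψ) := by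
    rw [← φ.quotKerEquivRange.length_eq, ← ψ.quotKerEquivRange.length_eq, hker]
  rw [hφ, hψ] at h
  rw [h]
  ring

theorem Ideal.length_quotient_le {J K : Ideal R} (h : J ≤ K) :
    Module.length R (R ⧸ K) ≤ Module.length R (R ⧸ J) := by
  rw [Ideal.length_quotient_eq_add h]
  exact le_self_add

end Length

/-! ### Existence of the Hilbert–Samuel polynomial via the Rees algebra -/

namespace Ideal

variable {R : Type*} [CommRing R]

/-- A homogeneous ideal `⨁ Fₙ tⁿ` of the Rees algebra `⨁ Iⁿ tⁿ`. -/
structure ReesFamily (I : Ideal R) where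
  /-- The component of degree `n`. -/
  N : ℕ → Ideal R
  le_pow : ∀ n, N n ≤ I ^ n
  mul_le : ∀ n, I * N n ≤ N (n + 1)

namespace ReesFamily

variable {I : Ideal R}

theorem pow_mul_le (F : I.ReesFamily) (k n : ℕ) : I ^ k * F.N n ≤ F.N (k + n) := by
  induction k with
  | zero => simp
  | succ k ih =>
    rw [pow_succ', mul_assoc, add_right_comm]
    exact (Ideal.mul_mono_right ih).trans (F.mul_le _)

/-- The ideal of the Rees algebra with homogeneous components `F.N n`. -/
def toIdeal (F : I.ReesFamily) : Ideal (reesAlgebra I) where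
  carrier := {p | ∀ n, (p : R[X]).coeff n ∈ F.N n}
  add_mem' hp hq n := by
    rw [Subalgebra.coe_add, coeff_add]
    exact add_mem (hp n) (hq n)
  zero_mem' n := by simp
  smul_mem' p q hq n := by
    rw [smul_eq_mul, Subalgebra.coe_mul, coeff_mul]
    refine _root_.sum_mem fun ij hij ↦ ?_
    rw [← Finset.HasAntidiagonal.mem_antidiagonal.1 hij]
    exact F.pow_mul_le _ _ (Ideal.mul_mem_mul ((mem_reesAlgebra_iff I _).1 p.2 _) (hq _))

theorem toIdeal_lt_toIdeal {F G : I.ReesFamily} (h : ∀ n, F.N n ≤ G.N n) {m : ℕ} {f : R}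
    (hf : f ∈ G.N m) (hfF : f ∉ F.N m) : F.toIdeal < G.toIdeal := by
  refine lt_of_le_of_ne (fun p hp n ↦ h n (hp n)) fun heq ↦ hfF ?_
  have hmem : (⟨monomial m f, reesAlgebra.monomial_mem.2 (G.le_pow m hf)⟩ : reesAlgebra I) ∈
      G.toIdeal := fun n ↦ by
    rw [coeff_monomial]
    split_ifs with hn
    · exact hn ▸ hf
    · exact zero_mem _
  rw [← heq] at hmem
  simpa using hmem m

/-- The homogeneous ideal `F : f tᵐ`. -/
def colon (F : I.ReesFamily) (m : ℕ) (f : R) : I.ReesFamily where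
  N n := I ^ n ⊓ Submodule.comap (LinearMap.mulLeft R f) (F.N (n + m))
  le_pow n := inf_le_left
  mul_le n := by
    refine Ideal.mul_le.2 fun a ha b hb ↦ ⟨?_, ?_⟩
    · rw [pow_succ']
      exact Ideal.mul_mem_mul ha hb.1
    · change f * (a * b) ∈ F.N (n + 1 + m)
      rw [mul_left_comm, add_right_comm]
      exact F.mul_le _ (Ideal.mul_mem_mul ha hb.2)

theorem mem_colon {F : I.ReesFamily} {m n : ℕ} {f a : R} :
    a ∈ (F.colon m f).N n ↔ a ∈ I ^ n ∧ f * a ∈ F.N (n + m) := Iff.rfl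

theorem le_colon (F : I.ReesFamily) {m : ℕ} {f : R} (hf : f ∈ I ^ m) (n : ℕ) :
    F.N n ≤ (F.colon m f).N n := fun _ ha ↦
  mem_colon.2 ⟨F.le_pow n ha, add_comm m n ▸ F.pow_mul_le m n (Ideal.mul_mem_mul hf ha)⟩

/-- The homogeneous ideal `F + (f tᵐ)`. -/
def adjoin (F : I.ReesFamily) (m : ℕ) (f : R) (hf : f ∈ I ^ m) : I.ReesFamily where
  N n := F.N n ⊔ Ideal.span {f} * (if m ≤ n then I ^ (n - m) else ⊥)
  le_pow n := by
    refine sup_le (F.le_pow n) ?_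
    split_ifs with h
    · conv_rhs => rw [← Nat.add_sub_cancel' h, pow_add]
      exact Ideal.mul_mono_left ((Ideal.span_singleton_le_iff_mem _).2 hf)
    · simp
  mul_le n := by
    rw [Ideal.mul_sup]
    refine sup_le_sup (F.mul_le n) ?_
    rw [mul_left_comm]
    refine Ideal.mul_mono_right ?_
    split_ifs with h h'
    · rw [← pow_succ', Nat.sub_add_comm h]
    · omega
    · simp
    · simp

theorem adjoin_N {F : I.ReesFamily} {m n : ℕ} {f : R} {hf : f ∈ I ^ m} (h : m ≤ n) :
    (F.adjoin m f hf).N n = F.N n ⊔ Ideal.span {f} * I ^ (n - m) := by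
  simp [adjoin, h]

theorem le_adjoin (F : I.ReesFamily) {m : ℕ} {f : R} (hf : f ∈ I ^ m) (n : ℕ) :
    F.N n ≤ (F.adjoin m f hf).N n := le_sup_left

theorem mem_adjoin (F : I.ReesFamily) {m : ℕ} {f : R} (hf : f ∈ I ^ m) :
    f ∈ (F.adjoin m f hf).N m := by
  rw [adjoin_N le_rfl]
  refine Submodule.mem_sup_right ?_
  simp

/-- The length of `Iⁿ / Fₙ` as a difference of colengths. -/
noncomputable def hilbertFun (F : I.ReesFamily) (n : ℕ) : ℚ :=
  ((Module.length R (R ⧸ F.N n)).toNat : ℚ) - (Module.length R (R ⧸ I ^ n)).toNat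

/-- This is the exact sequence 0 → (𝓡/(F : g))(-m) → 𝓡/F → 𝓡/(F + (g)) → 0 for g = f t^m in the Rees
algebra 𝓡, read in degree n. -/
theorem hilbertFun_eq_add (F : I.ReesFamily) (hfin : ∀ n, Module.length R (R ⧸ F.N n) ≠ ⊤)
    {m n : ℕ} {f : R} (hf : f ∈ I ^ m) (h : m ≤ n) :
    F.hilbertFun n = (F.adjoin m f hf).hilbertFun n + (F.colon m f).hilbertFun (n - m) := by
  have key := Ideal.length_quotient_add_length_quotient (J := F.N n) (A := I ^ (n - m))
    (B := (F.colon m f).N (n - m)) (f := f) fun a ↦ by rw [mem_colon, Nat.sub_add_cancel h]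
  rw [← adjoin_N (hf := hf) h] at key
  have h₁ := ne_top_of_le_ne_top (hfin n) (length_quotient_le (F.le_adjoin hf n))
  have h₂ := ne_top_of_le_ne_top (hfin (n - m)) (length_quotient_le (F.le_colon hf (n - m)))
  have h₃ := ne_top_of_le_ne_top (hfin (n - m)) (length_quotient_le (F.le_pow (n - m)))
  have := congrArg ENat.toNat key
  rw [ENat.toNat_add (hfin n) h₃, ENat.toNat_add h₁ h₂] at this
  have : ((Module.length R (R ⧸ F.N n)).toNat : ℚ) + (Module.length R (R ⧸ I ^ (n - m))).toNat =
    (Module.length R (R ⧸ (F.adjoin m f hf).N n)).toNat +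
      (Module.length R (R ⧸ (F.colon m f).N (n - m))).toNat := by exact_mod_cast this
  simp only [hilbertFun]
  linarith

/-- Noetherian induction on F. If some f t^m outside F is a zero divisor modulo F, both F + (f t^m)
and F : f t^m are strictly larger. Otherwise either F contains all of degree 1, or some f t of
degree 1 is a nonzerodivisor modulo F, and the first difference of the Hilbert function belongs to F
+ (f t). -/
theorem eventuallyPolynomial_hilbertFun [IsNoetherianRing R] (F : I.ReesFamily)
    (hfin : ∀ n, Module.length R (R ⧸ F.N n) ≠ ⊤) : EventuallyPolynomial F.hilbertFun := by
  induction F using (InvImage.wf toIdeal (wellFounded_gt (α := Ideal (reesAlgebra I)))).induction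
  with | _ F ih
  have ih' (G : I.ReesFamily) (h : ∀ n, F.N n ≤ G.N n) (m : ℕ) (f : R) (hf : f ∈ G.N m)
      (hfF : f ∉ F.N m) : EventuallyPolynomial G.hilbertFun :=
    ih G (toIdeal_lt_toIdeal h hf hfF) fun n ↦
      ne_top_of_le_ne_top (hfin n) (length_quotient_le (h n))
  by_cases hcase : ∃ (m : ℕ) (f : R), f ∈ I ^ m ∧ f ∉ F.N m ∧
      ∃ (n : ℕ) (a : R), a ∈ (F.colon m f).N n ∧ a ∉ F.N n
  · obtain ⟨m, f, hf, hfF, n, a, ha, haF⟩ := hcase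
    refine ((ih' _ (F.le_adjoin hf) m f (F.mem_adjoin hf) hfF).add
      ((ih' _ (F.le_colon hf) n a ha haF).comp_sub m)).congr ?_
    filter_upwards [eventually_ge_atTop m] with k hk using F.hilbertFun_eq_add hfin hf hk
  push Not at hcase
  by_cases hI : I ≤ F.N 1
  · refine EventuallyPolynomial.zero.congr ?_
    filter_upwards [eventually_ge_atTop 1] with n hn
    have : F.N n = I ^ n := by
      refine le_antisymm (F.le_pow n) ?_
      obtain ⟨k, rfl⟩ := Nat.exists_eq_add_of_le' hn
      rw [pow_succ]
      exact (Ideal.mul_mono_right hI).trans (F.pow_mul_le k 1)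
    rw [hilbertFun, this, sub_self]
  · obtain ⟨f, hf, hfF⟩ := SetLike.not_le_iff_exists.1 hI
    have hf' : f ∈ I ^ 1 := by rwa [pow_one]
    have hcolon (n : ℕ) : (F.colon 1 f).N n = F.N n :=
      le_antisymm (hcase 1 f hf' hfF n) (F.le_colon hf' n)
    refine EventuallyPolynomial.of_succ_sub ?_
    obtain ⟨P, hP⟩ := ih' _ (F.le_adjoin hf') 1 f (F.mem_adjoin hf') hfF
    refine ⟨P.comp (X + 1), ?_⟩
    filter_upwards [(tendsto_add_atTop_nat 1).eventually hP] with n hn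
    rw [F.hilbertFun_eq_add hfin hf' (Nat.le_add_left 1 n), hn, Nat.add_sub_cancel, hilbertFun,
      hilbertFun, hcolon]
    simp

end ReesFamily

/-- If all `R / Iⁿ` have finite length, then `λ(R / Iⁿ)` is a polynomial in `n` for large `n`. -/
theorem exists_isHilbertSamuelPoly [IsNoetherianRing R] {I : Ideal R}
    (hfin : ∀ n, Module.length R (R ⧸ I ^ n) ≠ ⊤) : ∃ P : ℚ[X], I.IsHilbertSamuelPoly P := by
  -- The quotient by this family is the associated graded ring; its Hilbert function is the first
  -- difference of λ(R/I^n).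
  let F : I.ReesFamily :=
    ⟨fun n ↦ I ^ (n + 1), fun n ↦ Ideal.pow_le_pow_right n.le_succ, fun n ↦ (pow_succ' I _).ge⟩
  have h : EventuallyPolynomial fun n ↦ ((Module.length R (R ⧸ I ^ n)).toNat : ℚ) :=
    EventuallyPolynomial.of_succ_sub
      (F.eventuallyPolynomial_hilbertFun fun n ↦ hfin (n + 1))
  obtain ⟨P, hP⟩ := h
  obtain ⟨N, hN⟩ := eventually_atTop.1 hP
  refine ⟨P, eventually_atTop.2 ⟨N, fun n hn ↦ ?_⟩⟩
  lift n to ℕ using by omega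
  simpa [hilbertSamuelFun] using (hN n (by exact_mod_cast hn)).symm

end Ideal

/-! ### Hilbert functions of I and I' -/

namespace Ideal

variable {R : Type*} [CommRing R] {I : Ideal R} {x : R}

theorem IsMaximalPrimary.length_quotient_pow_ne_top [IsLocalRing R] [IsNoetherianRing R]
    (hI : I.IsMaximalPrimary) (n : ℕ) : Module.length R (R ⧸ I ^ n) ≠ ⊤ := by
  have hart : IsArtinianRing (R ⧸ I ^ n) := by
    rcases Nat.eq_zero_or_pos n with rfl | hn
    · rw [pow_zero, one_eq_top]
      have : Subsingleton (R ⧸ (⊤ : Ideal R)) := Ideal.Quotient.subsingleton_iff.2 rfl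
      infer_instance
    · refine IsLocalRing.quotient_artinian_of_mem_minimalPrimes_of_isLocalRing _ ?_
      rw [← radical_minimalPrimes, I.radical_pow hn.ne', hI.2, minimalPrimes_eq_subsingleton_self]
      rfl
  rw [Module.length_eq_of_surjective (S := R) (R := R ⧸ I ^ n) Ideal.Quotient.mk_surjective]
  exact Module.length_ne_top

theorem hilbertSamuelFun_of_nonpos {n : ℤ} (hn : n ≤ 0) : I.hilbertSamuelFun n = 0 := by
  have : Subsingleton (R ⧸ I ^ 0) := Ideal.Quotient.subsingleton_iff.2 (by simp)
  rw [hilbertSamuelFun, Int.toNat_of_nonpos hn, Module.length_eq_zero, ENat.toNat_zero]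

theorem hilbertSamuelFun_pos (hfin : ∀ n, Module.length R (R ⧸ I ^ n) ≠ ⊤) (hI : I ≠ ⊤) {n : ℤ}
    (hn : 0 < n) : 0 < I.hilbertSamuelFun n := by
  have : Nontrivial (R ⧸ I ^ n.toNat) :=
    Ideal.Quotient.nontrivial_iff.2 (ne_top_of_le_ne_top hI (pow_le_self (by omega)))
  exact ENat.toNat_pos Module.length_pos.ne' (hfin _)

theorem length_quotient_modElement_pow (I : Ideal R) (x : R) (n : ℕ) :
    Module.length (R ⧸ span {x}) ((R ⧸ span {x}) ⧸ I.modElement x ^ n) =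
      Module.length R (R ⧸ (I ^ n ⊔ span {x})) := by
  rw [modElement, ← Ideal.map_pow, ← Module.length_eq_of_surjective (S := R)
    (R := R ⧸ span {x}) Ideal.Quotient.mk_surjective, sup_comm]
  exact (DoubleQuot.quotQuotEquivQuotSupₐ R (span {x}) (I ^ n)).toLinearEquiv.length_eq

/-- `λ(R / Iⁿ) = λ(S / I'ⁿ) + λ(R / (Iⁿ : x))`. -/
theorem hilbertSamuelFun_modElement_add (hfin : ∀ n, Module.length R (R ⧸ I ^ n) ≠ ⊤) (n : ℤ) :
    I.hilbertSamuelFun n = (I.modElement x).hilbertSamuelFun n +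
      (Module.length R (R ⧸ (I ^ n.toNat).colon {x})).toNat := by
  have key := length_quotient_add_length_quotient (J := I ^ n.toNat) (A := ⊤)
    (B := (I ^ n.toNat).colon {x}) (f := x) fun a ↦ by
      simp [Submodule.mem_colon_singleton, mul_comm]
  have : Subsingleton (R ⧸ (⊤ : Ideal R)) := Ideal.Quotient.subsingleton_iff.2 rfl
  have hle : I ^ n.toNat ≤ (I ^ n.toNat).colon {x} := fun a ha ↦
    Submodule.mem_colon_singleton.2 (Ideal.mul_mem_right _ _ ha)
  rw [Module.length_eq_zero (M := R ⧸ (⊤ : Ideal R)), add_zero, mul_top] at key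
  rw [hilbertSamuelFun, hilbertSamuelFun, length_quotient_modElement_pow, key, ENat.toNat_add]
  · exact ne_top_of_le_ne_top (hfin _) (length_quotient_le le_sup_left)
  · exact ne_top_of_le_ne_top (hfin _) (length_quotient_le hle)

theorem hilbertSamuelFun_modElement_of_colon_eq (hfin : ∀ n, Module.length R (R ⧸ I ^ n) ≠ ⊤)
    {n : ℕ} (h : (I ^ (n + 1)).colon {x} = I ^ n) :
    I.hilbertSamuelFun (n + 1) =
      (I.modElement x).hilbertSamuelFun (n + 1) + I.hilbertSamuelFun n := by
  rw [hilbertSamuelFun_modElement_add hfin (x := x)]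
  have : ((n : ℤ) + 1).toNat = n + 1 := by omega
  rw [hilbertSamuelFun, hilbertSamuelFun, this, h, Int.toNat_natCast]

theorem pow_le_colon (hx : x ∈ I) (n : ℕ) : I ^ n ≤ (I ^ (n + 1)).colon {x} := fun _ ha ↦
  Submodule.mem_colon_singleton.2 (pow_succ I n ▸ Ideal.mul_mem_mul ha hx)

theorem hilbertSamuelFun_lt_of_colon_ne (hfin : ∀ n, Module.length R (R ⧸ I ^ n) ≠ ⊤)
    (hx : x ∈ I) {n : ℕ} (h : (I ^ (n + 1)).colon {x} ≠ I ^ n) :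
    I.hilbertSamuelFun (n + 1) <
      (I.modElement x).hilbertSamuelFun (n + 1) + I.hilbertSamuelFun n := by
  have hle := pow_le_colon hx n
  rw [hilbertSamuelFun_modElement_add hfin (x := x)]
  have htop := hfin n
  have hadd := length_quotient_eq_add hle
  have hne : Module.length R (Submodule.map (I ^ n).mkQ ((I ^ (n + 1)).colon {x})) ≠ 0 := by
    rw [Ne, Module.length_eq_zero_iff, Submodule.subsingleton_iff_eq_bot, ← LinearMap.le_ker_iff_map,
      Submodule.ker_mkQ]
    exact fun h' ↦ h (le_antisymm h' hle)
  rw [hadd, Ne, ENat.add_eq_top, not_or] at htop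
  have htoNat := congrArg ENat.toNat hadd
  rw [ENat.toNat_add htop.1 htop.2] at htoNat
  have hpos := ENat.toNat_pos hne htop.2
  have : ((n : ℤ) + 1).toNat = n + 1 := by omega
  rw [this]
  simp only [hilbertSamuelFun, Int.toNat_natCast] at *
  omega

/-! ### Postulation numbers -/

section Postulation

theorem isLeast_postulationNumber (hfin : ∀ n, Module.length R (R ⧸ I ^ n) ≠ ⊤) (hI : I ≠ ⊤)
    {P : ℚ[X]} (hP : I.IsHilbertSamuelPoly P) :
    IsLeast {n : ℤ | ∀ t : ℤ, n < t → P.eval (t : ℚ) = I.hilbertSamuelFun t}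
      I.postulationNumber := by
  rw [postulationNumber, hP.hilbertSamuelPoly_eq]
  have hne : {n : ℤ | ∀ t : ℤ, n < t → P.eval (t : ℚ) = I.hilbertSamuelFun t}.Nonempty := by
    obtain ⟨N, hN⟩ := eventually_atTop.1 hP
    exact ⟨N, fun t ht ↦ hN t ht.le⟩
  have hbdd : BddBelow {n : ℤ | ∀ t : ℤ, n < t → P.eval (t : ℚ) = I.hilbertSamuelFun t} := by
    -- Otherwise P = H on all of ℤ; vanishing for n ≤ 0 forces P = 0, against H(1) > 0.
    by_contra hb
    have hall (t : ℤ) : P.eval (t : ℚ) = I.hilbertSamuelFun t := by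
      obtain ⟨n, hn, hnt⟩ := not_bddBelow_iff.1 hb t
      exact hn t hnt
    have hP0 : P = 0 := by
      refine Polynomial.eq_zero_of_infinite_isRoot P
        (((Set.Iic_infinite (0 : ℤ)).image (Int.cast_injective (α := ℚ)).injOn).mono ?_)
      rintro _ ⟨n, hn, rfl⟩
      change P.eval (n : ℚ) = 0
      rw [hall, hilbertSamuelFun_of_nonpos hn, Nat.cast_zero]
    have h₁ := hall 1
    rw [hP0, eval_zero] at h₁
    exact (hilbertSamuelFun_pos hfin hI one_pos).ne (by exact_mod_cast h₁)
  exact ⟨Int.csInf_mem hne hbdd, fun n hn ↦ csInf_le hbdd hn⟩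

variable (hfin : ∀ n, Module.length R (R ⧸ I ^ n) ≠ ⊤) (hI : I ≠ ⊤)
    {P : ℚ[X]} (hP : I.IsHilbertSamuelPoly P)

include hfin hI hP

theorem eval_eq_of_postulationNumber_lt {t : ℤ} (ht : I.postulationNumber < t) :
    P.eval (t : ℚ) = I.hilbertSamuelFun t :=
  (isLeast_postulationNumber hfin hI hP).1 t ht

theorem postulationNumber_le {n : ℤ}
    (h : ∀ t : ℤ, n < t → P.eval (t : ℚ) = I.hilbertSamuelFun t) : I.postulationNumber ≤ n :=
  (isLeast_postulationNumber hfin hI hP).2 h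

theorem le_postulationNumber {n : ℤ} (h : P.eval (n : ℚ) ≠ I.hilbertSamuelFun n) :
    n ≤ I.postulationNumber :=
  not_lt.1 fun hn ↦ h (eval_eq_of_postulationNumber_lt hfin hI hP hn)

theorem eval_postulationNumber_ne :
    P.eval (I.postulationNumber : ℚ) ≠ I.hilbertSamuelFun I.postulationNumber := fun h ↦ by
  have : I.postulationNumber ≤ I.postulationNumber - 1 := by
    refine postulationNumber_le hfin hI hP fun t ht ↦ ?_
    rcases (Int.le_of_sub_one_lt ht).eq_or_lt with rfl | ht'
    · exact h
    · exact eval_eq_of_postulationNumber_lt hfin hI hP ht'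
  omega

end Postulation

/-! ### Superficial elements and the Ratliff–Rush filtration -/

section Superficial

/-- A power of y moves a into I^c; superficiality then puts the product in every I^n, so it vanishes
by Krull's intersection theorem, and y cancels. -/
theorem IsSuperficial.eq_zero_of_mul_eq_zero [IsLocalRing R] [IsNoetherianRing R] (hx : I.IsSuperficial x)
    (hI : I ≠ ⊤) (hreg : ∃ y ∈ I.radical, IsSMulRegular R y) {a : R} (ha : a * x = 0) : a = 0 := by
  obtain ⟨-, c, hc, hsup⟩ := hx
  obtain ⟨y, ⟨k, hyk⟩, hy⟩ := hreg
  have hmem : y ^ (k * c) * a ∈ (⨅ n : ℕ, I ^ n : Ideal R) := by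
    have hIc : y ^ (k * c) * a ∈ I ^ c := by
      rw [pow_mul]
      exact Ideal.mul_mem_right _ _ (Ideal.pow_mem_pow hyk c)
    refine Submodule.mem_iInf _ |>.2 fun n ↦ ?_
    rcases le_total c n with hn | hn
    · rw [← hsup n hn]
      refine ⟨Submodule.mem_colon_singleton.2 ?_, hIc⟩
      rw [smul_eq_mul, mul_assoc, ha, mul_zero]
      exact zero_mem _
    · exact Ideal.pow_le_pow_right hn hIc
  rw [iInf_pow_eq_bot_of_isLocalRing I hI, Submodule.mem_bot] at hmem
  exact (hy.pow (k * c)) (by simpa using hmem)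

theorem IsSuperficial.exists_forall_colon_eq [IsNoetherianRing R] (hx : I.IsSuperficial x)
    (hreg : ∀ a, a * x = 0 → a = 0) :
    ∃ N : ℕ, ∀ n, N ≤ n → (I ^ (n + 1)).colon {x} = I ^ n := by
  obtain ⟨hxI, c, hc, hsup⟩ := hx
  -- Artin–Rees puts a * x in I^(n+1-k) x; cancelling x gives a ∈ I^c once n ≥ k + c, as
  -- superficiality requires.
  obtain ⟨k, hk⟩ := I.exists_pow_inf_eq_pow_smul (M := R) (span {x})
  refine ⟨k + c, fun n hn ↦ ?_⟩
  refine le_antisymm (fun a ha ↦ ?_) (pow_le_colon hxI n)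
  rw [← hsup n (by omega)]
  refine ⟨ha, ?_⟩
  rw [Submodule.mem_colon_singleton, smul_eq_mul] at ha
  have hmem : a * x ∈ I ^ (n + 1) • (⊤ : Submodule R R) ⊓ span {x} :=
    ⟨by simpa using ha, Ideal.mem_span_singleton'.2 ⟨a, rfl⟩⟩
  rw [hk (n + 1) (by omega)] at hmem
  have hmem' : a * x ∈ I ^ (n + 1 - k) * span {x} :=
    Submodule.smul_mono le_rfl inf_le_right hmem
  obtain ⟨b, hb, hba⟩ := Ideal.mem_mul_span_singleton.1 hmem'
  have hab : b = a := sub_eq_zero.1 (hreg _ (by rw [sub_mul, hba, sub_self]))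
  exact Ideal.pow_le_pow_right (by omega) (hab ▸ hb)

theorem mem_of_mul_pow_mem {N : ℕ} (hN : ∀ n, N ≤ n → (I ^ (n + 1)).colon {x} = I ^ n) {n k : ℕ}
    (hn : N ≤ n) {a : R} (ha : a * x ^ k ∈ I ^ (n + k)) : a ∈ I ^ n := by
  induction k with
  | zero => simpa using ha
  | succ k ih =>
    refine ih ?_
    rw [← hN (n + k) (by omega), Submodule.mem_colon_singleton, smul_eq_mul, mul_assoc, ← pow_succ]
    exact ha

/-- If `x` is eventually a nonzerodivisor on the associated graded ring, the Ratliff–Rush closure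
of `Iⁿ` is the union of the ideals `(Iⁿ⁺ᵏ : xᵏ)`. -/
theorem mem_ratliffRush_pow (hx : x ∈ I)
    (hN : ∃ N : ℕ, ∀ n, N ≤ n → (I ^ (n + 1)).colon {x} = I ^ n) {n : ℕ} (hn : 1 ≤ n) {a : R} :
    a ∈ (I ^ n).ratliffRush ↔ ∃ k : ℕ, a * x ^ k ∈ I ^ (n + k) := by
  obtain ⟨N, hN⟩ := hN
  rw [mem_ratliffRush]
  constructor
  · rintro ⟨k, -, hk⟩
    refine ⟨n * k, ?_⟩
    have := hk (x ^ (n * k)) (by rw [← pow_mul]; exact Ideal.pow_mem_pow hx _)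
    rwa [← pow_mul, mul_add, mul_one, add_comm] at this
  · rintro ⟨k, hk⟩
    -- The product a * b is tested in degree n(N+2) ≥ N, where x^k can be cancelled.
    refine ⟨N + 1, by omega, fun b hb ↦ ?_⟩
    rw [← pow_mul] at hb ⊢
    have hle : N ≤ n * (N + 1 + 1) := by nlinarith
    refine mem_of_mul_pow_mem (k := k) hN hle ?_
    have := Ideal.mul_mem_mul hk hb
    rw [← pow_add] at this
    convert this using 1
    · ring
    · ring_nf

theorem mem_ratliffRush_pow_succ (hx : x ∈ I)
    (hN : ∃ N : ℕ, ∀ n, N ≤ n → (I ^ (n + 1)).colon {x} = I ^ n) {n : ℕ} (hn : 1 ≤ n) {a : R} :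
    a * x ∈ (I ^ (n + 1)).ratliffRush ↔ a ∈ (I ^ n).ratliffRush := by
  rw [mem_ratliffRush_pow hx hN hn, mem_ratliffRush_pow hx hN (by omega)]
  constructor
  · rintro ⟨k, hk⟩
    refine ⟨k + 1, ?_⟩
    rw [← add_assoc, add_right_comm, pow_succ', ← mul_assoc]
    exact hk
  · rintro ⟨k, hk⟩
    refine ⟨k, ?_⟩
    rw [mul_right_comm, add_right_comm, pow_succ]
    exact Ideal.mul_mem_mul hk hx

theorem le_ratliffRush (I : Ideal R) : I ≤ I.ratliffRush := fun a ha ↦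
  mem_ratliffRush.2 ⟨1, le_rfl, fun b hb ↦ by
    rw [pow_succ', pow_one]
    exact Ideal.mul_mem_mul ha (by simpa using hb)⟩

theorem stabilityIndex_spec (hx : x ∈ I)
    (hN : ∃ N : ℕ, ∀ n, N ≤ n → (I ^ (n + 1)).colon {x} = I ^ n) :
    1 ≤ I.stabilityIndex ∧ ∀ n, I.stabilityIndex ≤ n → (I ^ n).ratliffRush = I ^ n := by
  refine Nat.sInf_mem (s := {i : ℕ | 1 ≤ i ∧ ∀ n : ℕ, i ≤ n → (I ^ n).ratliffRush = I ^ n}) ?_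
  obtain ⟨N, hN'⟩ := hN
  refine ⟨N + 1, by omega, fun n hn ↦ le_antisymm (fun a ha ↦ ?_) (le_ratliffRush _)⟩
  obtain ⟨k, hk⟩ := (mem_ratliffRush_pow hx ⟨N, hN'⟩ (by omega)).1 ha
  exact mem_of_mul_pow_mem hN' (by omega) hk

theorem colon_eq_of_stabilityIndex_le (hx : x ∈ I)
    (hN : ∃ N : ℕ, ∀ n, N ≤ n → (I ^ (n + 1)).colon {x} = I ^ n) {n : ℕ}
    (hn : I.stabilityIndex ≤ n) : (I ^ (n + 1)).colon {x} = I ^ n := by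
  obtain ⟨h₁, h₂⟩ := stabilityIndex_spec hx hN
  ext a
  rw [Submodule.mem_colon_singleton, smul_eq_mul, ← h₂ n hn, ← h₂ (n + 1) (by omega),
    mem_ratliffRush_pow_succ hx hN (by omega)]

/-- Equality would carry Ratliff–Rush closedness from I^(n+1) down to I^n, against minimality of the
index. For n = 0 the claim fails, since (I : x) = R. -/
theorem colon_ne_of_stabilityIndex_eq (hx : x ∈ I)
    (hN : ∃ N : ℕ, ∀ n, N ≤ n → (I ^ (n + 1)).colon {x} = I ^ n) {n : ℕ}
    (hn : 1 ≤ n) (hn' : I.stabilityIndex = n + 1) : (I ^ (n + 1)).colon {x} ≠ I ^ n := fun h ↦ by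
  obtain ⟨h₁, h₂⟩ := stabilityIndex_spec hx hN
  have hmem : n ∈ {i : ℕ | 1 ≤ i ∧ ∀ n : ℕ, i ≤ n → (I ^ n).ratliffRush = I ^ n} := by
    refine ⟨hn, fun m hm ↦ ?_⟩
    rcases hm.eq_or_lt with rfl | hm
    · ext a
      rw [← mem_ratliffRush_pow_succ hx hN hn, h₂ (n + 1) hn'.le, ← smul_eq_mul,
        ← Submodule.mem_colon_singleton, h]
    · exact h₂ m (by omega)
  have : I.stabilityIndex ≤ n := Nat.sInf_le hmem
  omega

end Superficial

end Ideal

/-! ### Comparison of the postulation numbers -/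

theorem IsCohenMacaulayLocal.exists_isSMulRegular {R : Type*} [CommRing R] [IsLocalRing R]
    (hCM : IsCohenMacaulayLocal R) (hdim : 0 < ringKrullDim R) :
    ∃ y ∈ IsLocalRing.maximalIdeal R, IsSMulRegular R y := by
  obtain ⟨-, rs, hrs, hreg, hlen⟩ := hCM
  cases rs with
  | nil =>
    rw [← hlen] at hdim
    simp at hdim
  | cons y rs =>
    exact ⟨y, hrs y (by simp), ((RingTheory.Sequence.isRegular_cons_iff _ _ _).1 hreg).1⟩

theorem proposition3p1 {R : Type*} [CommRing R] [IsLocalRing R]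
    (hCM : IsCohenMacaulayLocal R) (hdim : 0 < ringKrullDim R)
    (hres : Infinite (IsLocalRing.ResidueField R))
    (I : Ideal R) (hI : I.IsMaximalPrimary) (x : R) (hx : I.IsSuperficial x) :
    (I.postulationNumber > (I.stabilityIndex : ℤ) - 1 →
        (I.modElement x).postulationNumber = I.postulationNumber + 1) ∧
      (I.postulationNumber = (I.stabilityIndex : ℤ) - 1 →
        (I.modElement x).postulationNumber ≤ I.postulationNumber + 1) ∧
      (I.postulationNumber < (I.stabilityIndex : ℤ) - 1 →
        (I.modElement x).postulationNumber ≥ I.postulationNumber + 1) := by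
  have hnoeth : IsNoetherianRing R := hCM.1
  have hxI := hx.1
  have hItop : I ≠ ⊤ := hI.1.ne_top
  have hfin := hI.length_quotient_pow_ne_top
  have hN := hx.exists_forall_colon_eq fun a ↦
    hx.eq_zero_of_mul_eq_zero hItop (hI.2 ▸ hCM.exists_isSMulRegular hdim)
  have hρ := (Ideal.stabilityIndex_spec hxI hN).1
  have hItop' : I.modElement x ≠ ⊤ := fun h ↦ by
    have hker : RingHom.ker (Ideal.Quotient.mk (Ideal.span {x})) ≤ I := by
      rw [Ideal.mk_ker]
      exact (Ideal.span_singleton_le_iff_mem _).2 hxI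
    have := Ideal.comap_map_of_surjective' _ (Ideal.Quotient.mk_surjective (I := Ideal.span {x})) I
    rw [sup_eq_left.2 hker, ← Ideal.modElement, h, Ideal.comap_top] at this
    exact hItop this.symm
  have hfin' (n : ℕ) : Module.length (R ⧸ Ideal.span {x})
      ((R ⧸ Ideal.span {x}) ⧸ I.modElement x ^ n) ≠ ⊤ := by
    rw [Ideal.length_quotient_modElement_pow]
    exact ne_top_of_le_ne_top (hfin n) (Ideal.length_quotient_le le_sup_left)
  obtain ⟨P, hP⟩ := Ideal.exists_isHilbertSamuelPoly hfin
  have hfun (t : ℤ) (ht : (I.stabilityIndex : ℤ) < t ∨ t ≤ 0) :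
      (I.hilbertSamuelFun t : ℚ) =
        (I.modElement x).hilbertSamuelFun t + I.hilbertSamuelFun (t - 1) := by
    rcases ht with ht | ht
    · obtain ⟨n, rfl⟩ : ∃ n : ℕ, t = n + 1 := ⟨(t - 1).toNat, by omega⟩
      have := Ideal.hilbertSamuelFun_modElement_of_colon_eq hfin
        (Ideal.colon_eq_of_stabilityIndex_le hxI hN (n := n) (by omega))
      rw [add_sub_cancel_right]
      exact_mod_cast this
    · simp [Ideal.hilbertSamuelFun_of_nonpos ht,
        Ideal.hilbertSamuelFun_of_nonpos (show t - 1 ≤ 0 by omega)]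
  set Q : ℚ[X] := P - P.comp (X - 1) with hQdef
  have hQ (t : ℤ) : Q.eval (t : ℚ) = P.eval (t : ℚ) - P.eval ((t - 1 : ℤ) : ℚ) := by simp [hQdef]
  have hPQ : (I.modElement x).IsHilbertSamuelPoly Q := by
    filter_upwards [hP, (tendsto_atTop_add_const_right atTop (-1 : ℤ) tendsto_id).eventually hP,
      eventually_gt_atTop (I.stabilityIndex : ℤ)] with t h₁ h₂ h₃
    rw [hQ, h₁, hfun t (Or.inl h₃)]
    simp only [id, ← sub_eq_add_neg] at h₂
    rw [h₂]
    ring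
  have hlt {t : ℤ} : I.postulationNumber < t → P.eval (t : ℚ) = I.hilbertSamuelFun t :=
    Ideal.eval_eq_of_postulationNumber_lt hfin hItop hP
  have hne := Ideal.eval_postulationNumber_ne hfin hItop hP
  have hle (h : (I.stabilityIndex : ℤ) - 1 ≤ I.postulationNumber) :
      (I.modElement x).postulationNumber ≤ I.postulationNumber + 1 := by
    refine Ideal.postulationNumber_le hfin' hItop' hPQ fun t ht ↦ ?_
    rw [hQ, hlt (by omega), hlt (by omega), hfun t (by omega)]
    ring
  have hge (h : (I.stabilityIndex : ℤ) < I.postulationNumber + 1 ∨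
      I.postulationNumber + 1 ≤ 0) :
      I.postulationNumber + 1 ≤ (I.modElement x).postulationNumber := by
    refine Ideal.le_postulationNumber hfin' hItop' hPQ fun heq ↦ hne ?_
    rw [hQ, hlt (by omega), hfun _ h, add_sub_cancel_right] at heq
    linarith
  refine ⟨fun h ↦ le_antisymm (hle (by omega)) (hge (by omega)), fun h ↦ hle h.ge, fun h ↦ ?_⟩
  -- If ρ = 1 then n(I) + 1 ≤ 0, where the difference formula holds because every term is zero.
  rcases hρ.eq_or_lt with h₁ | h₁
  · exact hge (by omega)
  · obtain ⟨n, hn⟩ : ∃ n : ℕ, I.stabilityIndex = n + 1 := ⟨I.stabilityIndex - 1, by omega⟩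
    have hstrict := Ideal.hilbertSamuelFun_lt_of_colon_ne hfin hxI
      (Ideal.colon_ne_of_stabilityIndex_eq hxI hN (n := n) (by omega) hn)
    have : (n : ℤ) + 1 ≤ (I.modElement x).postulationNumber := by
      refine Ideal.le_postulationNumber hfin' hItop' hPQ fun heq ↦ ?_
      rw [hQ, hlt (by omega), hlt (by omega), add_sub_cancel_right, sub_eq_iff_eq_add] at heq
      exact hstrict.ne (by exact_mod_cast heq)
    omega
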